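/- Let $\omega=\{0,1,2,\dots\}$. An ideal on $\omega$ is a family of subsets of $\omega$ that is closed under subsets and finite unions, contains all finite sets, and is not the whole power set. For an ideal $\mathcal I$, a sequence $\boldsymbol{x}=(x_n)$ in a topological space is $\mathcal I$-convergent to $\eta$, written $\mathcal I\text{-}\lim_n x_n=\eta$, if $\{n: x_n\notin U\}\in\mathcal I$ for every neighborhood $U$ of $\eta$. For a Banach space $V$, let $c^b(V,\mathcal I)$ be the set of norm-bounded sequences in $V$ that are $\mathcal I$-convergent to some element of $V$. Let $X$ be an AM-space with order unit $e$, that is, a real Banach lattice with $\|x\vee y\|=\max\{\|x\|,\|y\|\}$ for all $x,y\ge 0$, and an element $e\in X$ such that for every $x\in X$ there is $n\in\omega$ with $-ne\le x\le ne$. Let $Y$ be a real Banach lattice, let $\mathcal I,\mathcal J$ be ideals on $\omega$, let $T:X\to Y$ be a linear map, and let $A=(A_{n,k})_{n,k\in\omega}$ be a matrix of positive linear maps $A_{n,k}:X\to Y$ (that is, $A_{n,k}x\ge 0$ whenever $x\ge 0$). For $n\in\omega$ and $E\subseteq\omega$ let $$\|A_{n,E}\|:=\sup\Big\{\Big\|\sum_{k\in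 F}A_{n,k}x_k\Big\| : F\subseteq E \text{ finite},\ x_k\in X,\ \|x_k\|\le 1\Big\}\in[0,\infty],$$ and write $\|A_{n,\ge k}\|:=\|A_{n,\{k,k+1,\dots\}}\|$. Assume that (T3$^\natural$) $\lim_k\|A_{n,\ge k}\|=0$ for all $n\in\omega$. The matrix $A$ is called $(\mathcal I,\mathcal J)$-regular with respect to $T$ if for every $\boldsymbol{x}\in c^b(X,\mathcal I)$ each series $A_n\boldsymbol{x}:=\sum_k A_{n,k}x_k$ converges in the norm of $Y$, the sequence $A\boldsymbol{x}:=(A_n\boldsymbol{x})_n$ belongs to $c^b(Y,\mathcal J)$, and $\mathcal J\text{-}\lim A\boldsymbol{x}=T(\mathcal I\text{-}\lim\boldsymbol{x})$. **Theorem.** $A$ is $(\mathcal I,\mathcal J)$-regular with respect to $T$ if and only if the following three conditions hold: * (T1, with $k_0=0$) $\sup_n\|A_{n,\omega}\|<\infty$; * (T4) for every $x\in X$, the series $\sum_k A_{n,k}x$ converges in the norm of $Y$ for each $n\in\omega$, and $\mathcal J\text{-}\lim_n\sum_k A_{n,k}x=Tx$; * (T6) $\mathcal J\text{-}\lim_n\|A_{n,E}\|=0$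 for every $E\in\mathcal I$. -/

import Mathlib

open Filter Topology
open scoped ENNReal

/-- An ideal on the nonnegative integers, closed under subsets and finite unions, which contains
all finite sets and is different from the power set. -/
structure NatIdeal where
  sets : Set (Set ℕ)
  subset_mem : ∀ {S S' : Set ℕ}, S ∈ sets → S' ⊆ S → S' ∈ sets
  union_mem : ∀ {S S' : Set ℕ}, S ∈ sets → S' ∈ sets → S ∪ S' ∈ sets
  finite_mem : ∀ {S : Set ℕ}, S.Finite → S ∈ sets
  univ_notMem : Set.univ ∉ sets

/-- `x` is `I`-convergent to `η`. -/
def NatIdeal.Conv {V : Type*} [TopologicalSpace V] (I : NatIdeal) (x : ℕ → V) (η : V) : Prop :=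
  ∀ U ∈ 𝓝 η, {n | x n ∉ U} ∈ I.sets

/-- The space of bounded `I`-convergent sequences with values in `V`. -/
def boundedConvSeq (V : Type*) [NormedAddCommGroup V] (I : NatIdeal) : Set (ℕ → V) :=
  {x | (∃ η, I.Conv x η) ∧ ∃ C : ℝ, ∀ n, ‖x n‖ ≤ C}

/-- A vector lattice whose norm is an M-norm. Together with the Banach lattice assumptions this
says that `V` is an AM-space. -/
def IsMNorm (V : Type*) [NormedAddCommGroup V] [Lattice V] : Prop :=
  ∀ x y : V, 0 ≤ x → 0 ≤ y → ‖x ⊔ y‖ = max ‖x‖ ‖y‖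

/-- `e` is an order unit. -/
def IsOrderUnit {V : Type*} [NormedAddCommGroup V] [Lattice V] (e : V) : Prop :=
  ∀ x : V, ∃ n : ℕ, -(n • e) ≤ x ∧ x ≤ n • e

namespace OpMatrix

section

variable {X Y : Type*} [NormedAddCommGroup X] [NormedSpace ℝ X]
  [NormedAddCommGroup Y] [NormedSpace ℝ Y]

/-- The group norm, with values in `[0, ∞]`, of the family `(S k : k ∈ E)`. -/
noncomputable def groupNorm (S : ℕ → X →ₗ[ℝ] Y) (E : Set ℕ) : ℝ≥0∞ :=
  ⨆ (F : Finset ℕ) (_ : (F : Set ℕ) ⊆ E) (x : ℕ → X) (_ : ∀ k, ‖x k‖ ≤ 1),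
    ‖∑ k ∈ F, S k (x k)‖ₑ

/-- `y` is the `A`-transform of `x`: for every `n` the series `∑ₖ A n k (x k)` converges in norm
(as the limit of its partial sums) to `y n`. -/
def IsTransform (A : ℕ → ℕ → X →ₗ[ℝ] Y) (x : ℕ → X) (y : ℕ → Y) : Prop :=
  ∀ n, Tendsto (fun N => ∑ k ∈ Finset.range N, A n k (x k)) atTop (𝓝 (y n))

/-- `A` belongs to the matrix class `(𝒜, ℬ)`: every sequence of `𝒜` is in the domain of `A` and
its `A`-transform is in `ℬ`. -/
def MemClass (A : ℕ → ℕ → X →ₗ[ℝ] Y) (𝒜 : Set (ℕ → X)) (ℬ : Set (ℕ → Y)) : Prop :=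
  ∀ x ∈ 𝒜, ∃ y ∈ ℬ, IsTransform A x y

/-- `A` is `(I, J)`-regular with respect to `T`. -/
def IsRegular (I J : NatIdeal) (A : ℕ → ℕ → X →ₗ[ℝ] Y) (T : X →ₗ[ℝ] Y) : Prop :=
  MemClass A (boundedConvSeq X I) (boundedConvSeq Y J) ∧
    ∀ x ∈ boundedConvSeq X I, ∀ η y, I.Conv x η → IsTransform A x y → J.Conv y (T η)

/-- The group norms of the row tails starting at `k₀` are uniformly bounded. -/
def RowTailsBounded (A : ℕ → ℕ → X →ₗ[ℝ] Y) (k₀ : ℕ) : Prop :=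
  (⨆ n, groupNorm (A n) (Set.Ici k₀)) < ∞

/-- For every `n`, the group norms of the tails of the `n`th row tend to zero. -/
def RowTailsVanish (A : ℕ → ℕ → X →ₗ[ℝ] Y) : Prop :=
  ∀ n, Tendsto (fun k => groupNorm (A n) (Set.Ici k)) atTop (𝓝 0)

/-- `J-lim_n ∑ₖ A n k = T` in the strong operator topology; all the series are required to
converge. -/
def RowSumsConv (J : NatIdeal) (A : ℕ → ℕ → X →ₗ[ℝ] Y) (T : X →ₗ[ℝ] Y) : Prop :=
  ∀ x : X, ∃ y, IsTransform A (fun _ => x) y ∧ J.Conv y (T x)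

/-- `J-lim_n ‖A_{n,E}‖ = 0` for every `E ∈ I`. -/
def IdealPartsVanish (I J : NatIdeal) (A : ℕ → ℕ → X →ₗ[ℝ] Y) : Prop :=
  ∀ E ∈ I.sets, J.Conv (fun n => groupNorm (A n) E) 0

end

end OpMatrix

/-! Necessity rests on domination by the order unit. The unit ball lies below `C • e`, so for
positive operators the group norm over `E` is at most `C` times the norm of the transform of a
nonnegative sequence equal to `e` on `E` (`groupNorm_le_of_tendsto`). The constant sequence `e`
gives the uniform bound; `e` on `E` and zero elsewhere gives vanishing along `E ∈ I`. Sufficiency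
needs no order: `conv_transform` compares `x` with the constant sequence at its limit, splitting the
indices by closeness to the limit. Vanishing row tails make the series converge. -/

/-- In a Banach lattice with order unit `e`, the unit ball lies below a multiple of `e`. -/
theorem IsOrderUnit.exists_unitBall_le {X : Type*}
    [NormedAddCommGroup X] [NormedSpace ℝ X] [CompleteSpace X]
    [Lattice X] [IsOrderedAddMonoid X] [IsOrderedModule ℝ X] [HasSolidNorm X]
    {e : X} (he : IsOrderUnit e) (he0 : 0 ≤ e) :
    ∃ C : ℝ, 0 ≤ C ∧ ∀ x : X, ‖x‖ ≤ 1 → x ≤ C • e := by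
  by_contra! h
  -- In `4 ^ m = 2 ^ m * 2 ^ m`, one factor undoes the summation weight `(1 / 2) ^ m` and the other
  -- dominates the multiple `m` of `e` bounding the sum.
  choose x hx1 hx2 using fun n : ℕ => h ((4 : ℝ) ^ n) (by positivity)
  have hnn : ∀ n, 0 ≤ ((1 / 2 : ℝ) ^ n) • |x n| := fun n =>
    smul_nonneg (by positivity) (abs_nonneg _)
  have hsum : Summable fun n => ((1 / 2 : ℝ) ^ n) • |x n| := by
    refine Summable.of_norm_bounded summable_geometric_two fun n => ?_
    rw [norm_smul, norm_abs_eq_norm, Real.norm_of_nonneg (by positivity)]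
    exact mul_le_of_le_one_right (by positivity) (hx1 n)
  obtain ⟨m, -, hm⟩ := he (∑' n, ((1 / 2 : ℝ) ^ n) • |x n|)
  refine hx2 m ((le_abs_self _).trans ?_)
  have h1 : ((1 / 2 : ℝ) ^ m) • |x m| ≤ (m : ℝ) • e := by
    rw [Nat.cast_smul_eq_nsmul]
    exact (hsum.le_tsum m fun n _ => hnn n).trans hm
  have h2 := smul_le_smul_of_nonneg_left h1 (show (0 : ℝ) ≤ 2 ^ m by positivity)
  rw [smul_smul, smul_smul, ← mul_pow, mul_one_div_cancel two_ne_zero, one_pow, one_smul] at h2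
  refine h2.trans (smul_le_smul_of_nonneg_right ?_ he0)
  have h3 : (m : ℝ) ≤ 2 ^ m := by exact_mod_cast Nat.lt_two_pow_self.le
  calc (2 : ℝ) ^ m * m ≤ 2 ^ m * 2 ^ m := by gcongr
    _ = 4 ^ m := by rw [← mul_pow]; norm_num

theorem IsOrderUnit.nonneg {X : Type*} [NormedAddCommGroup X] [NormedSpace ℝ X]
    [Lattice X] [IsOrderedAddMonoid X] [IsOrderedModule ℝ X]
    {e : X} (he : IsOrderUnit e) : 0 ≤ e := by
  obtain ⟨n, hn, -⟩ := he e
  have h1 : 0 ≤ ((n : ℝ) + 1) • e := by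
    rw [add_smul, one_smul, Nat.cast_smul_eq_nsmul]
    exact neg_le_iff_add_nonneg'.mp hn
  have h2 := smul_nonneg (show (0 : ℝ) ≤ ((n : ℝ) + 1)⁻¹ by positivity) h1
  rwa [smul_smul, inv_mul_cancel₀ (by positivity), one_smul] at h2

theorem NatIdeal.conv_const {V : Type*} [TopologicalSpace V] (I : NatIdeal) (η : V) :
    I.Conv (fun _ => η) η := fun U hU => by
  simpa [mem_of_mem_nhds hU] using I.finite_mem Set.finite_empty

namespace OpMatrix

section

variable {X Y : Type*} [NormedAddCommGroup X] [NormedSpace ℝ X]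
  [NormedAddCommGroup Y] [NormedSpace ℝ Y]

theorem enorm_sum_le_groupNorm (S : ℕ → X →ₗ[ℝ] Y) {E : Set ℕ} {F : Finset ℕ}
    (hF : (F : Set ℕ) ⊆ E) {x : ℕ → X} (hx : ∀ k, ‖x k‖ ≤ 1) :
    ‖∑ k ∈ F, S k (x k)‖ₑ ≤ groupNorm S E :=
  le_iSup₂_of_le F hF (le_iSup₂_of_le x hx le_rfl)

theorem groupNorm_mono (S : ℕ → X →ₗ[ℝ] Y) {E E' : Set ℕ} (h : E ⊆ E') :
    groupNorm S E ≤ groupNorm S E' :=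
  iSup₂_le fun _ hF => iSup₂_le fun _ hx => enorm_sum_le_groupNorm S (hF.trans h) hx

/-- By homogeneity: rescale by `B⁻¹` and put zero off `F`, since the group norm tests families
bounded at every index. -/
theorem norm_sum_le_mul_groupNorm (S : ℕ → X →ₗ[ℝ] Y) {E : Set ℕ} (hE : groupNorm S E ≠ ∞)
    {F : Finset ℕ} (hF : (F : Set ℕ) ⊆ E) {x : ℕ → X} {B : ℝ} (hB : 0 < B)
    (hx : ∀ k ∈ F, ‖x k‖ ≤ B) :
    ‖∑ k ∈ F, S k (x k)‖ ≤ B * (groupNorm S E).toReal := by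
  have h1 : ∀ k, ‖if k ∈ F then B⁻¹ • x k else 0‖ ≤ 1 := fun k => by
    split_ifs with hk
    · rw [norm_smul, norm_inv, Real.norm_of_nonneg hB.le]
      exact inv_mul_le_one_of_le₀ (hx k hk) hB.le
    · simp
  have h2 := ENNReal.toReal_mono hE (enorm_sum_le_groupNorm S hF h1)
  have h3 : ∑ k ∈ F, S k (if k ∈ F then B⁻¹ • x k else 0) = B⁻¹ • ∑ k ∈ F, S k (x k) := by
    rw [Finset.smul_sum]
    exact Finset.sum_congr rfl fun k hk => by simp [hk]
  rw [h3, toReal_enorm, norm_smul, norm_inv, Real.norm_of_nonneg hB.le] at h2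
  exact (inv_mul_le_iff₀ hB).mp h2

/-- Where the tails of the `n`th row vanish, bounded sequences have a transform. -/
theorem exists_isTransform [CompleteSpace Y] {A : ℕ → ℕ → X →ₗ[ℝ] Y} (hA : RowTailsVanish A)
    {x : ℕ → X} {C : ℝ} (hx : ∀ k, ‖x k‖ ≤ C) : ∃ y, IsTransform A x y := by
  suffices h : ∀ n, ∃ z, Tendsto (fun N => ∑ k ∈ Finset.range N, A n k (x k)) atTop (𝓝 z) by
    choose y hy using h
    exact ⟨y, hy⟩
  intro n
  refine cauchySeq_tendsto_of_complete (Metric.cauchySeq_iff'.mpr fun ε hε => ?_)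
  set B := max C 1
  have hB : 0 < B := lt_max_of_lt_right one_pos
  have hδ : 0 < ε / (2 * B) := by positivity
  obtain ⟨N, hN⟩ := ((hA n).eventually (Iic_mem_nhds (ENNReal.ofReal_pos.mpr hδ))).exists
  refine ⟨N, fun M hM => ?_⟩
  rw [dist_eq_norm, ← Finset.sum_Ico_eq_sub _ hM]
  have h1 := norm_sum_le_mul_groupNorm (A n) (E := Set.Ici N) (F := Finset.Ico N M)
    (ne_top_of_le_ne_top ENNReal.ofReal_ne_top hN)
    (fun k hk => (Finset.mem_Ico.mp hk).1) hB
    (fun k _ => (hx k).trans (le_max_left C 1))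
  have h2 : (groupNorm (A n) (Set.Ici N)).toReal ≤ ε / (2 * B) :=
    ENNReal.toReal_le_of_le_ofReal hδ.le hN
  calc _ ≤ _ := h1
    _ ≤ B * (ε / (2 * B)) := by gcongr
    _ = ε / 2 := by field_simp
    _ < ε := half_lt_self hε

theorem RowTailsBounded.exists_bound {A : ℕ → ℕ → X →ₗ[ℝ] Y} (hA : RowTailsBounded A 0) :
    ∃ M : ℝ, 0 < M ∧ ∀ n E, groupNorm (A n) E ≠ ∞ ∧ (groupNorm (A n) E).toReal ≤ M := by
  have h : ∀ n E, groupNorm (A n) E ≤ ⨆ n, groupNorm (A n) (Set.Ici 0) := fun n E =>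
    (groupNorm_mono (A n) fun k _ => Nat.zero_le k).trans
      (le_iSup (fun n => groupNorm (A n) (Set.Ici 0)) n)
  -- The `+ 1` makes the bound positive, so that it can be divided by.
  refine ⟨(⨆ n, groupNorm (A n) (Set.Ici 0)).toReal + 1, by positivity, fun n E =>
    ⟨ne_top_of_le_ne_top hA.ne (h n E), ?_⟩⟩
  exact (ENNReal.toReal_mono hA.ne (h n E)).trans (by linarith)

theorem RowTailsBounded.exists_norm_transform_le {A : ℕ → ℕ → X →ₗ[ℝ] Y}
    (hA : RowTailsBounded A 0) {x : ℕ → X} {C : ℝ} (hx : ∀ k, ‖x k‖ ≤ C) {y : ℕ → Y}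
    (hy : IsTransform A x y) : ∃ D : ℝ, ∀ n, ‖y n‖ ≤ D := by
  obtain ⟨M, -, hM⟩ := hA.exists_bound
  refine ⟨max C 1 * M, fun n => le_of_tendsto' (hy n).norm fun N => ?_⟩
  refine (norm_sum_le_mul_groupNorm (A n) (hM n Set.univ).1 (Set.subset_univ _)
    (lt_max_of_lt_right one_pos) fun k _ => (hx k).trans (le_max_left C 1)).trans ?_
  gcongr
  exact (hM n _).2

/-- Bounded row norms, strong convergence of the row sums and vanishing of the parts along the
ideal imply that transforms converge to the right limit. -/
theorem conv_transform {I J : NatIdeal} {A : ℕ → ℕ → X →ₗ[ℝ] Y} {T : X →ₗ[ℝ] Y}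
    (hb : RowTailsBounded A 0) (hs : RowSumsConv J A T) (hI : IdealPartsVanish I J A)
    {x : ℕ → X} {C : ℝ} (hx : ∀ k, ‖x k‖ ≤ C) {η : X} (hη : I.Conv x η)
    {y : ℕ → Y} (hy : IsTransform A x y) : J.Conv y (T η) := by
  obtain ⟨M, hM0, hM⟩ := hb.exists_bound
  obtain ⟨w, hw, hwT⟩ := hs η
  intro U hU
  obtain ⟨ε, hε, hεU⟩ := Metric.mem_nhds_iff.mp hU
  have hδ : 0 < ε / (4 * M) := by positivity
  set B := max (C + ‖η‖) 1
  have hB : 0 < B := lt_max_of_lt_right one_pos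
  have hγ : 0 < ε / (4 * B) := by positivity
  -- On `E` the differences `x k - η` are only bounded by `B`, but the group norm is small; off `E`
  -- they are small and the group norm is at most `M`. Each part contributes `ε / 4`.
  set E : Set ℕ := {k | x k ∉ Metric.ball η (ε / (4 * M))}
  have hE : E ∈ I.sets := hη _ (Metric.ball_mem_nhds η hδ)
  have h1 := hI E hE _ (Iic_mem_nhds (ENNReal.ofReal_pos.mpr hγ))
  have h2 := hwT _ (Metric.ball_mem_nhds (T η) (half_pos hε))
  refine J.subset_mem (J.union_mem h1 h2) fun n hn => ?_
  by_contra hcon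
  simp only [Set.mem_union, Set.mem_ofPred_eq, not_or, not_not, Set.mem_Iic, Metric.mem_ball]
    at hcon
  refine hn (hεU ?_)
  have key : ‖y n - w n‖ ≤ B * (ε / (4 * B)) + ε / (4 * M) * M := by
    refine le_of_tendsto' ((hy n).sub (hw n)).norm fun N => ?_
    classical
    rw [← Finset.sum_sub_distrib, ← Finset.sum_filter_add_sum_filter_not _ (· ∈ E)]
    simp only [← map_sub]
    refine (norm_add_le _ _).trans (add_le_add ?_ ?_)
    · refine (norm_sum_le_mul_groupNorm (A n) (E := E) (x := fun k => x k - η) (hM n E).1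
        (fun k hk => by simpa using (Finset.mem_filter.mp hk).2) hB fun k _ => ?_).trans ?_
      · exact (norm_sub_le _ _).trans ((add_le_add_left (hx k) _).trans (le_max_left _ _))
      · gcongr
        exact ENNReal.toReal_le_of_le_ofReal hγ.le hcon.1
    · refine (norm_sum_le_mul_groupNorm (A n) (E := Set.univ) (x := fun k => x k - η)
        (hM n _).1 (Set.subset_univ _) hδ fun k hk => ?_).trans ?_
      · have := (Finset.mem_filter.mp hk).2
        simp only [E, Set.mem_ofPred_eq, not_not, Metric.mem_ball, dist_eq_norm] at this
        exact this.le
      · gcongr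
        exact (hM n _).2
  have e1 : B * (ε / (4 * B)) = ε / 4 := by field_simp
  have e2 : ε / (4 * M) * M = ε / 4 := by field_simp
  rw [e1, e2] at key
  rw [Metric.mem_ball]
  calc dist (y n) (T η) ≤ dist (y n) (w n) + dist (w n) (T η) := dist_triangle _ _ _
    _ < (ε / 4 + ε / 4) + ε / 2 := by
      refine add_lt_add_of_le_of_lt ?_ hcon.2
      rwa [dist_eq_norm]
    _ = ε := by ring

end

section

variable {X Y : Type*} [NormedAddCommGroup X] [NormedSpace ℝ X]
  [Lattice X] [IsOrderedAddMonoid X]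
  [NormedAddCommGroup Y] [NormedSpace ℝ Y]
  [Lattice Y] [IsOrderedAddMonoid Y] [IsOrderedModule ℝ Y] [HasSolidNorm Y]

/-- If the unit ball lies below `C • e`, the group norm over `E` of a family of positive operators
is controlled by the sum of their values at `e` along `E`. -/
theorem groupNorm_le_of_tendsto {S : ℕ → X →ₗ[ℝ] Y} (hS : ∀ k x, 0 ≤ x → 0 ≤ S k x)
    {e : X} {C : ℝ} (hC0 : 0 ≤ C) (hC : ∀ x : X, ‖x‖ ≤ 1 → x ≤ C • e)
    {E : Set ℕ} {u : ℕ → X} (hu0 : ∀ k, 0 ≤ u k) (hu : ∀ k ∈ E, u k = e) {z : Y}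
    (hz : Tendsto (fun N => ∑ k ∈ Finset.range N, S k (u k)) atTop (𝓝 z)) :
    groupNorm S E ≤ ENNReal.ofReal (C * ‖z‖) := by
  have hmono : ∀ k {a b : X}, a ≤ b → S k a ≤ S k b := fun k a b hab => by
    simpa using hS k (b - a) (sub_nonneg.mpr hab)
  refine iSup₂_le fun F hF => iSup₂_le fun x hx => ?_
  rw [← ofReal_norm]
  refine ENNReal.ofReal_le_ofReal ?_
  -- All terms are nonnegative, so a finite subsum stays below the limit.
  have h1 : ∑ k ∈ F, S k (u k) ≤ z := by
    refine ge_of_tendsto hz ((eventually_ge_atTop (F.sup id + 1)).mono fun N hN => ?_)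
    refine Finset.sum_le_sum_of_subset_of_nonneg (fun k hk => ?_) fun k _ _ => hS k _ (hu0 k)
    exact Finset.mem_range.mpr ((Nat.lt_succ_of_le (Finset.le_sup (f := id) hk)).trans_le hN)
  have h2 : ∀ v : ℕ → X, (∀ k, ‖v k‖ ≤ 1) → ∑ k ∈ F, S k (v k) ≤ C • z := fun v hv => by
    refine le_trans ?_ (smul_le_smul_of_nonneg_left h1 hC0)
    rw [Finset.smul_sum]
    refine Finset.sum_le_sum fun k hk => ?_
    rw [← map_smul, hu k (hF hk)]
    exact hmono k (hC _ (hv k))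
  -- Applying `h2` to both `x` and `-x` bounds the absolute value; solidity of the norm then
  -- finishes.
  have h3 : |∑ k ∈ F, S k (x k)| ≤ C • z := by
    refine abs_le'.mpr ⟨h2 x hx, ?_⟩
    have := h2 (fun k => -x k) fun k => by simpa using hx k
    simpa using this
  refine (norm_le_norm_of_abs_le_abs (h3.trans (le_abs_self _))).trans ?_
  rw [norm_smul, Real.norm_of_nonneg hC0]

end

end OpMatrix

theorem theorem2p8 {X Y : Type*}
    [NormedAddCommGroup X] [NormedSpace ℝ X] [CompleteSpace X]
    [Lattice X] [IsOrderedAddMonoid X] [IsOrderedModule ℝ X] [HasSolidNorm X]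
    [NormedAddCommGroup Y] [NormedSpace ℝ Y] [CompleteSpace Y]
    [Lattice Y] [IsOrderedAddMonoid Y] [IsOrderedModule ℝ Y] [HasSolidNorm Y]
    (hX : IsMNorm X) (e : X) (he : IsOrderUnit e)
    (I J : NatIdeal) (T : X →ₗ[ℝ] Y) (A : ℕ → ℕ → X →ₗ[ℝ] Y)
    (hpos : ∀ n k, ∀ x : X, 0 ≤ x → 0 ≤ A n k x)
    (hT3 : OpMatrix.RowTailsVanish A) :
    OpMatrix.IsRegular I J A T ↔
      OpMatrix.RowTailsBounded A 0 ∧ OpMatrix.RowSumsConv J A T ∧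
        OpMatrix.IdealPartsVanish I J A := by
  classical
  constructor
  · rintro ⟨hmem, hlim⟩
    have he0 := he.nonneg
    obtain ⟨C, hC0, hC⟩ := he.exists_unitBall_le he0
    have hconst : ∀ x : X, (fun _ => x) ∈ boundedConvSeq X I := fun x =>
      ⟨⟨x, I.conv_const x⟩, ‖x‖, fun _ => le_rfl⟩
    refine ⟨?_, fun x => ?_, fun E hE => ?_⟩
    · obtain ⟨y, ⟨-, D, hD⟩, hy⟩ := hmem _ (hconst e)
      refine (iSup_le fun n => ?_).trans_lt (ENNReal.ofReal_lt_top (r := C * D))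
      refine (OpMatrix.groupNorm_le_of_tendsto (hpos n) hC0 hC (fun _ => he0)
        (fun _ _ => rfl) (hy n)).trans (ENNReal.ofReal_le_ofReal ?_)
      exact mul_le_mul_of_nonneg_left (hD n) hC0
    · obtain ⟨y, -, hy⟩ := hmem _ (hconst x)
      exact ⟨y, hy, hlim _ (hconst x) x y (I.conv_const x) hy⟩
    -- This sequence is `I`-convergent to `0` because its support lies in `E ∈ I`, so its transform
    -- `J`-converges to `T 0 = 0`.
    · set u : ℕ → X := fun k => if k ∈ E then e else 0
      have hu : I.Conv u 0 := fun U hU => I.subset_mem hE fun k hk => by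
        by_contra hkE
        exact hk (by simpa [u, hkE] using mem_of_mem_nhds hU)
      have hub : u ∈ boundedConvSeq X I := ⟨⟨0, hu⟩, ‖e‖, fun k => by
        by_cases hk : k ∈ E <;> simp [u, hk]⟩
      obtain ⟨y, -, hy⟩ := hmem _ hub
      have hy0 := hlim u hub 0 y hu hy
      rw [map_zero] at hy0
      have hcont : Tendsto (fun z : Y => ENNReal.ofReal (C * ‖z‖)) (𝓝 0) (𝓝 0) := by
        have : Continuous fun z : Y => ENNReal.ofReal (C * ‖z‖) :=
          ENNReal.continuous_ofReal.comp (continuous_const.mul continuous_norm)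
        simpa using this.tendsto 0
      intro U hU
      obtain ⟨ε, hε, hεU⟩ := ENNReal.nhds_zero_basis_Iic.mem_iff.mp hU
      refine J.subset_mem (hy0 _ (hcont (Iic_mem_nhds hε))) fun n hn hn' => hn (hεU ?_)
      refine (OpMatrix.groupNorm_le_of_tendsto (hpos n) hC0 hC (fun k => ?_)
        (fun k hk => ?_) (hy n)).trans hn'
      · by_cases hk : k ∈ E <;> simp [u, hk, he0]
      · simp [u, hk]
  · rintro ⟨hb, hs, hI⟩
    refine ⟨?_, fun x ⟨_, C, hx⟩ η y hη hy => OpMatrix.conv_transform hb hs hI hx hη hy⟩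
    rintro x ⟨⟨η, hη⟩, C, hx⟩
    obtain ⟨y, hy⟩ := OpMatrix.exists_isTransform hT3 hx
    exact ⟨y, ⟨⟨T η, OpMatrix.conv_transform hb hs hI hx hη hy⟩,
      hb.exists_norm_transform_le hx hy⟩, hy⟩
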